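/- Let $p\in[1,\infty)$, let $G$ be a countable discrete group, and let $A$ be a separable $L^p$ operator algebra, that is, a separable complex Banach algebra (not necessarily unital) which has an isometric representation on some space $L^p(X,\mu)$; here a representation of $A$ on a Banach space $E$ is an algebra homomorphism $A\to\mathcal B(E)$. Let $\alpha$ be an action of $G$ on $A$ by isometric automorphisms. Assume that $A$ has unique $L^p$ operator matrix norms: whenever $\mu,\nu$ are $\sigma$-finite measures on $X,Y$ with $L^p(X,\mu)$ and $L^p(Y,\nu)$ separable, and $\pi:A\to\mathcal B(L^p(X,\mu))$, $\sigma:A\to\mathcal B(L^p(Y,\nu))$ are isometric representations, then for all $n$ and all $(a_{ij})\in M_n(A)$ the operators $(\pi(a_{ij}))_{i,j}$ on $L^p(\{1,\dots,n\}\times X)$ and $(\sigma(a_{ij}))_{i,j}$ on $L^p(\{1,\dots,n\}\times Y)$ (with counting measure on $\{1,\dots,n\}$) have the same norm. Let $C_c(G,A,\alpha)$ be the algebra of finitely supported functions $f:G\to A$ with product $(f*g)(t)=\sum_{s\in G}f(s)\,\alpha_s(g(s^{-1}t))$. For a contractive representation $\pi_0$ of $A$ on $E_0$, put, for $a\in A$,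 $s,t\in G$ and $\xi\in l^p(G,E_0)$, $$(\pi(a)\xi)(s)=\pi_0(\alpha_{s^{-1}}(a))(\xi(s)),\qquad (\lambda_p^{E_0}(s)\xi)(t)=\xi(s^{-1}t),\qquad (\pi\rtimes\lambda_p^{E_0})(f)=\sum_{s\in G}\pi(f(s))\,\lambda_p^{E_0}(s)\quad(f\in C_c(G,A,\alpha)).$$ Call $\pi_0$ nondegenerate if the linear span of $\pi_0(A)E_0$ is dense in $E_0$. Let $F^p_\lambda(G,A,\alpha)$ be the Banach algebra obtained by completing $C_c(G,A,\alpha)$ in $\|f\|=\sup\|(\pi\rtimes\lambda_p^{E_0})(f)\|$, where the supremum is over all nondegenerate contractive representations $\pi_0$ of $A$ on spaces $E_0=L^p(X,\mu)$ with $\mu$ $\sigma$-finite. Let $\pi_0:A\to\mathcal B(E_0)$ be a nondegenerate isometric representation of $A$ on a space $E_0=L^p(X,\mu)$ with $\mu$ $\sigma$-finite. Then $\pi\rtimes\lambda_p^{E_0}$ extends to an isometric representation $F^p_\lambda(G,A,\alpha)\to\mathcal B(l^p(G,E_0))$. -/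

import Mathlib

open MeasureTheory
open scoped ENNReal

universe u v w

noncomputable section

namespace LpCrossed

/-! ### Actions and representations -/

/-- An isometric action of a discrete group `G` on a complex normed algebra `A`: a group
homomorphism from `G` to the isometric algebra automorphisms of `A` (each `α s` is bijective, with
inverse `α s⁻¹`). As `G` is discrete there is no continuity condition. -/
structure IsometricAction (G : Type v) (A : Type w) [Group G] [NonUnitalNormedRing A]
    [NormedSpace ℂ A] where
  toFun : G → A →ₙₐ[ℂ] A
  map_one' : ∀ a : A, toFun 1 a = a
  map_mul' : ∀ (s t : G) (a : A), toFun (s * t) a = toFun s (toFun t a)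
  norm_map' : ∀ (s : G) (a : A), ‖toFun s a‖ = ‖a‖

instance {G : Type v} {A : Type w} [Group G] [NonUnitalNormedRing A] [NormedSpace ℂ A] :
    CoeFun (IsometricAction G A) (fun _ => G → A →ₙₐ[ℂ] A) :=
  ⟨IsometricAction.toFun⟩

/-- A contractive representation of `A` on `E`: an algebra homomorphism `A → B(E)` that does not
increase the norm. Neither `A` nor the homomorphism need be unital. -/
structure ContractiveRep (A : Type w) (E : Type u) [NonUnitalNormedRing A] [NormedSpace ℂ A]
    [NormedAddCommGroup E] [NormedSpace ℂ E] where
  hom : A →ₙₐ[ℂ] (E →L[ℂ] E)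
  norm_le : ∀ a : A, ‖hom a‖ ≤ ‖a‖

namespace ContractiveRep

variable {A : Type w} {E : Type u} [NonUnitalNormedRing A] [NormedSpace ℂ A]
  [NormedAddCommGroup E] [NormedSpace ℂ E]

/-- The representation is isometric. -/
def IsIsometric (π : ContractiveRep A E) : Prop := ∀ a : A, ‖π.hom a‖ = ‖a‖

/-- The linear span of `{π(a) ξ : a ∈ A, ξ ∈ E}` is dense in `E`. -/
def Nondegenerate (π : ContractiveRep A E) : Prop :=
  Dense (Submodule.span ℂ {η : E | ∃ (a : A) (ξ : E), π.hom a ξ = η} : Set E)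

/-- The zero representation. -/
def zero (A : Type w) (E : Type u) [NonUnitalNormedRing A] [NormedSpace ℂ A]
    [NormedAddCommGroup E] [NormedSpace ℂ E] : ContractiveRep A E where
  hom := 0
  norm_le a := by simp

end ContractiveRep

/-- `A` is an `L^p` operator algebra: a Banach algebra (completeness is a hypothesis on `A`) with an
isometric representation on some space `L^p(X, μ)`. -/
def IsLpOperatorAlgebra (p : ℝ≥0∞) [Fact (1 ≤ p)] (A : Type w) [NonUnitalNormedRing A]
    [NormedSpace ℂ A] : Prop :=
  ∃ (X : Type u) (_ : MeasurableSpace X) (μ : Measure X) (π : ContractiveRep A (Lp ℂ p μ)),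
    π.IsIsometric

/-! ### Matrix norms -/

/-- The amplification of `π` to `n × n` matrices over `A`, acting on the `ℓ^p` direct sum of `n`
copies of `E` by `(ξ_j)_j ↦ (∑_j π(a_{ij}) ξ_j)_i`. For `E = L^p(X, μ)` this direct sum is
`L^p({1, …, n} × X, ν × μ)` with `ν` the counting measure. -/
def amplify (p : ℝ≥0∞) [Fact (1 ≤ p)] {A : Type w} {E : Type u} [NonUnitalNormedRing A]
    [NormedSpace ℂ A] [NormedAddCommGroup E] [NormedSpace ℂ E] (π : ContractiveRep A E) {n : ℕ}
    (a : Matrix (Fin n) (Fin n) A) :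
    PiLp p (fun _ : Fin n => E) →L[ℂ] PiLp p (fun _ : Fin n => E) :=
  ((PiLp.continuousLinearEquiv p ℂ (fun _ : Fin n => E)).symm :
      (Fin n → E) →L[ℂ] PiLp p (fun _ : Fin n => E)) ∘L
    (ContinuousLinearMap.pi fun i => ∑ j, π.hom (a i j) ∘L ContinuousLinearMap.proj j) ∘L
    (PiLp.continuousLinearEquiv p ℂ (fun _ : Fin n => E) :
      PiLp p (fun _ : Fin n => E) →L[ℂ] (Fin n → E))

theorem amplify_apply (p : ℝ≥0∞) [Fact (1 ≤ p)] {A : Type w} {E : Type u} [NonUnitalNormedRing A]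
    [NormedSpace ℂ A] [NormedAddCommGroup E] [NormedSpace ℂ E] (π : ContractiveRep A E) {n : ℕ}
    (a : Matrix (Fin n) (Fin n) A) (ξ : PiLp p (fun _ : Fin n => E)) (i : Fin n) :
    amplify p π a ξ i = ∑ j, π.hom (a i j) (ξ j) := by
  simp [amplify]

/-- `A` has unique `L^p` operator matrix norms: for any two isometric representations `π`, `σ` on
separable `L^p` spaces of `σ`-finite measures, `σ ∘ π⁻¹ : π(A) → σ(A)` is completely isometric. -/
def HasUniqueLpMatrixNorms (p : ℝ≥0∞) [Fact (1 ≤ p)] (A : Type w) [NonUnitalNormedRing A]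
    [NormedSpace ℂ A] : Prop :=
  ∀ (X Y : Type u) [MeasurableSpace X] [MeasurableSpace Y] (μ : Measure X) (ν : Measure Y)
    [SigmaFinite μ] [SigmaFinite ν] [TopologicalSpace.SeparableSpace (Lp ℂ p μ)]
    [TopologicalSpace.SeparableSpace (Lp ℂ p ν)]
    (π : ContractiveRep A (Lp ℂ p μ)) (σ : ContractiveRep A (Lp ℂ p ν)),
    π.IsIsometric → σ.IsIsometric →
      ∀ (n : ℕ) (a : Matrix (Fin n) (Fin n) A), ‖amplify p σ a‖ = ‖amplify p π a‖

/-! ### Regular covariant representations -/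

/-- The space `l^p(G, E)`. -/
abbrev lpG (p : ℝ≥0∞) (G : Type v) (E : Type u) [NormedAddCommGroup E] : Type (max v u) :=
  lp (fun _ : G => E) p

theorem memlp_comp_equiv (p : ℝ≥0∞) {G : Type v} {E : Type u} [NormedAddCommGroup E]
    (e : G ≃ G) (ξ : lpG p G E) : Memℓp (fun t => ξ (e t)) p := by
  have h := lp.memℓp ξ
  obtain (rfl | rfl | hp') := p.trichotomy
  · rw [memℓp_zero_iff] at h ⊢
    exact h.preimage e.injective.injOn
  · rw [memℓp_infty_iff] at h ⊢
    exact h.mono (Set.range_comp_subset_range e fun t => ‖ξ t‖)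
  · rw [memℓp_gen_iff hp'] at h ⊢
    exact (e.summable_iff (f := fun t => ‖ξ t‖ ^ p.toReal)).2 h

section Regular

variable (p : ℝ≥0∞) [Fact (1 ≤ p)] {G : Type v} {A : Type w} {E : Type u} [Group G]
  [NonUnitalNormedRing A] [NormedSpace ℂ A] [NormedAddCommGroup E] [NormedSpace ℂ E]

theorem ne_zero_of_fact (p : ℝ≥0∞) [hp : Fact (1 ≤ p)] : p ≠ 0 := fun h => by
  have := hp.out
  simp [h] at this

theorem norm_regPi_apply_le (α : IsometricAction G A) (π₀ : ContractiveRep A E) (a : A) (s : G)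
    (x : E) : ‖π₀.hom (α s⁻¹ a) x‖ ≤ ‖a‖ * ‖x‖ :=
  (ContinuousLinearMap.le_opNorm _ _).trans
    (mul_le_mul_of_nonneg_right ((π₀.norm_le _).trans (α.norm_map' _ _).le) (norm_nonneg _))

/-- The operator `π(a)` on `l^p(G, E)`, `(π(a) ξ)(s) = π₀(α_{s⁻¹}(a)) (ξ(s))`. -/
def regPi (α : IsometricAction G A) (π₀ : ContractiveRep A E) (a : A) :
    lpG p G E →L[ℂ] lpG p G E :=
  LinearMap.mkContinuous
    { toFun := fun ξ => ⟨fun s => π₀.hom (α s⁻¹ a) (ξ s),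
        (((lp.memℓp ξ).norm.const_mul ‖a‖)).mono fun s =>
          norm_regPi_apply_le α π₀ a s (ξ s)⟩
      map_add' := fun ξ η => by
        ext s
        exact map_add (π₀.hom (α s⁻¹ a)) (ξ s) (η s)
      map_smul' := fun c ξ => by ext s; simp }
    ‖a‖ fun ξ => by
      have h : ‖((‖a‖ : ℂ) • ξ : lpG p G E)‖ = ‖a‖ * ‖ξ‖ := by
        rw [norm_smul]; simp
      rw [← h]
      refine lp.norm_mono (ne_zero_of_fact p) fun s => ?_
      have h2 : ‖((‖a‖ : ℂ) • ξ : lpG p G E) s‖ = ‖a‖ * ‖ξ s‖ := by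
        rw [lp.coeFn_smul, Pi.smul_apply, norm_smul]; simp
      rw [h2]
      exact norm_regPi_apply_le α π₀ a s (ξ s)

theorem regPi_apply (α : IsometricAction G A) (π₀ : ContractiveRep A E) (a : A)
    (ξ : lpG p G E) (s : G) : regPi p α π₀ a ξ s = π₀.hom (α s⁻¹ a) (ξ s) := rfl

theorem norm_regPi_le (α : IsometricAction G A) (π₀ : ContractiveRep A E) (a : A) :
    ‖regPi p α π₀ a‖ ≤ ‖a‖ :=
  LinearMap.mkContinuous_norm_le _ (norm_nonneg _) _

/-- The left translation `λ(s)` on `l^p(G, E)`, `(λ(s) ξ)(t) = ξ(s⁻¹ t)`. -/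
def lam (E : Type u) [NormedAddCommGroup E] [NormedSpace ℂ E] (s : G) :
    lpG p G E →L[ℂ] lpG p G E :=
  LinearMap.mkContinuous
    { toFun := fun ξ => ⟨fun t => ξ (s⁻¹ * t), memlp_comp_equiv p (Equiv.mulLeft s⁻¹) ξ⟩
      map_add' := fun ξ η => by ext t; rfl
      map_smul' := fun c ξ => by ext t; rfl }
    1 fun ξ => by
      rw [one_mul]
      obtain (h0 | rfl | hp') := p.trichotomy
      · exact absurd h0 (ne_zero_of_fact p)
      · exact lp.norm_le_of_forall_le (norm_nonneg _) fun t =>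
          lp.norm_apply_le_norm (by simp) ξ (s⁻¹ * t)
      · refine lp.norm_le_of_tsum_le hp' (norm_nonneg _) ?_
        rw [lp.norm_rpow_eq_tsum hp']
        exact ((Equiv.mulLeft s⁻¹).tsum_eq (fun t => ‖ξ t‖ ^ p.toReal)).le

theorem lam_apply (s : G) (ξ : lpG p G E) (t : G) : lam p E s ξ t = ξ (s⁻¹ * t) := rfl

theorem norm_lam_le (s : G) : ‖lam p E s‖ ≤ 1 :=
  LinearMap.mkContinuous_norm_le _ zero_le_one _

end Regular

/-! ### The twisted convolution algebra -/

/-- The space `C_c(G, A, α)` of finitely supported functions `G → A` (`G` being discrete). The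
parameter `p` and the universe `a` only serve to attach to it below the norm of
`F^p_λ(G, A, α)`, a supremum over representations on spaces `L^p(X, μ)` with `X : Type a` (the
`let` only makes this universe a parameter of the type). -/
@[nolint unusedArguments]
def Cc.{a, b, c} (_p : ℝ≥0∞) {G : Type b} {A : Type c} [Group G] [NonUnitalNormedRing A]
    [NormedSpace ℂ A] (_α : IsometricAction.{b, c} G A) : Type (max b c) :=
  let _ := PUnit.{a + 1}
  G →₀ A

section Algebra

variable {p : ℝ≥0∞} {G : Type v} {A : Type w} [Group G]
  [NonUnitalNormedRing A] [NormedSpace ℂ A] {α : IsometricAction G A}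

instance : AddCommGroup (Cc.{u, v, w} p α) := Finsupp.instAddCommGroup (ι := G) (G := A)

instance : Module ℂ (Cc.{u, v, w} p α) := Finsupp.module G A

namespace Cc

/-- An element of `C_c(G, A, α)`, as a finitely supported function. -/
def toFinsupp (f : Cc.{u, v, w} p α) : G →₀ A := f

/-- The function supported at `s` with value `a` there. -/
def single (s : G) (a : A) : Cc.{u, v, w} p α := Finsupp.single s a

theorem single_add (s : G) (a b : A) :
    (single s (a + b) : Cc.{u, v, w} p α) = single s a + single s b := Finsupp.single_add s a b

theorem single_zero (s : G) : (single s 0 : Cc.{u, v, w} p α) = 0 := Finsupp.single_zero s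

theorem smul_single (c : ℂ) (s : G) (a : A) :
    (c • single s a : Cc.{u, v, w} p α) = single s (c • a) := Finsupp.smul_single c s a

@[elab_as_elim]
theorem induction {P : Cc.{u, v, w} p α → Prop} (f : Cc.{u, v, w} p α) (h0 : P 0)
    (hadd : ∀ f g, P f → P g → P (f + g)) (hs : ∀ s a, P (single s a)) : P f :=
  Finsupp.induction_linear f h0 hadd hs

/-- The additive map on `C_c(G, A, α)` given by `f ↦ ∑_s F_s(f(s))`. -/
def sumHom {N : Type*} [AddCommMonoid N] (F : G → A →+ N) : Cc.{u, v, w} p α →+ N :=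
  Finsupp.liftAddHom F

theorem sumHom_apply {N : Type*} [AddCommMonoid N] (F : G → A →+ N) (f : Cc.{u, v, w} p α) :
    sumHom F f = ∑ s ∈ (toFinsupp f).support, F s (toFinsupp f s) := rfl

theorem sumHom_single {N : Type*} [AddCommMonoid N] (F : G → A →+ N) (s : G) (a : A) :
    sumHom F (single s a : Cc.{u, v, w} p α) = F s a :=
  Finsupp.liftAddHom_apply_single F s a

/-- Twisted convolution as a biadditive map: the bilinear extension of
`(a δ_s) * (b δ_t) = a α_s(b) δ_{st}`. -/
def mulHom : Cc.{u, v, w} p α →+ Cc.{u, v, w} p α →+ Cc.{u, v, w} p α :=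
  sumHom fun s => AddMonoidHom.mk'
    (fun a => sumHom fun t => AddMonoidHom.mk' (fun b => single (s * t) (a * α s b))
      fun b b' => by rw [map_add, mul_add, single_add])
    fun a a' => by
      ext f
      induction f using Cc.induction with
      | h0 => simp
      | hadd f g hf hg => rw [map_add, map_add, hf, hg]
      | hs t b => simp [sumHom_single, add_mul, single_add]

instance : Mul (Cc.{u, v, w} p α) := ⟨fun f g => mulHom f g⟩

theorem mul_def (f g : Cc.{u, v, w} p α) : f * g = mulHom f g := rfl

theorem single_mul_single (s t : G) (a b : A) :
    (single s a * single t b : Cc.{u, v, w} p α) = single (s * t) (a * α s b) := by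
  simp [mul_def, mulHom, sumHom_single]

instance : NonUnitalRing (Cc.{u, v, w} p α) where
  left_distrib f g h := by simp [mul_def]
  right_distrib f g h := by simp [mul_def]
  zero_mul f := by simp [mul_def]
  mul_zero f := by simp [mul_def]
  mul_assoc f g h := by
    induction f using Cc.induction with
    | h0 => simp [mul_def]
    | hadd f f' hf hf' => simp only [mul_def, map_add, AddMonoidHom.add_apply] at *; rw [hf, hf']
    | hs r a =>
      induction g using Cc.induction with
      | h0 => simp [mul_def]
      | hadd f f' hf hf' => simp only [mul_def, map_add, AddMonoidHom.add_apply] at *; rw [hf, hf']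
      | hs s b =>
        induction h using Cc.induction with
        | h0 => simp [mul_def]
        | hadd f f' hf hf' => simp only [mul_def, map_add] at *; rw [hf, hf']
        | hs t c => simp only [single_mul_single, mul_assoc, map_mul, α.map_mul']

/-- The product is twisted convolution, `(f * g)(t) = ∑_s f(s) α_s(g(s⁻¹ t))`. -/
theorem mul_apply (f g : Cc.{u, v, w} p α) (t : G) :
    toFinsupp (f * g) t =
      ∑ s ∈ (toFinsupp f).support, toFinsupp f s * α s (toFinsupp g (s⁻¹ * t)) := by
  classical
  let L : Cc.{u, v, w} p α →+ A := sumHom fun s => AddMonoidHom.mk'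
    (fun a => a * α s (toFinsupp g (s⁻¹ * t))) fun a b => add_mul a b _
  change toFinsupp (f * g) t = L f
  have hadd : ∀ (x y : Cc.{u, v, w} p α) (r : G),
    toFinsupp (x + y) r = toFinsupp x r + toFinsupp y r := fun _ _ _ => rfl
  induction f using Cc.induction with
  | h0 => rw [zero_mul, map_zero]; rfl
  | hadd f f' hf hf' => rw [add_mul, map_add, hadd, hf, hf']
  | hs s a =>
    simp only [L, sumHom_single, AddMonoidHom.mk'_apply]
    clear L
    induction g using Cc.induction with
    | h0 =>
      have h0 : ∀ r, toFinsupp (0 : Cc.{u, v, w} p α) r = 0 := fun _ => rfl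
      rw [mul_zero, h0, h0, map_zero, mul_zero]
    | hadd g g' hg hg' => rw [mul_add, hadd, hadd, hg, hg', map_add, mul_add]
    | hs r b =>
      rw [single_mul_single]
      simp only [toFinsupp, single, Finsupp.single_apply]
      by_cases h : s * r = t
      · subst h; simp
      · have : r ≠ s⁻¹ * t := fun h' => h (by rw [h']; group)
        simp [h, this]

instance [IsScalarTower ℂ A A] : IsScalarTower ℂ (Cc.{u, v, w} p α) (Cc.{u, v, w} p α) where
  smul_assoc c f g := by
    simp only [smul_eq_mul]
    induction f using Cc.induction with
    | h0 => simp
    | hadd f f' hf hf' => rw [smul_add, add_mul, add_mul, smul_add, hf, hf']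
    | hs s a =>
      induction g using Cc.induction with
      | h0 => simp
      | hadd f f' hf hf' => rw [mul_add, mul_add, smul_add, hf, hf']
      | hs t b => simp only [smul_single, single_mul_single, smul_mul_assoc]

instance [SMulCommClass ℂ A A] : SMulCommClass ℂ (Cc.{u, v, w} p α) (Cc.{u, v, w} p α) where
  smul_comm c f g := by
    simp only [smul_eq_mul]
    induction f using Cc.induction with
    | h0 => simp
    | hadd f f' hf hf' => rw [add_mul, add_mul, smul_add, hf, hf']
    | hs s a =>
      induction g using Cc.induction with
      | h0 => simp
      | hadd f f' hf hf' => rw [smul_add, mul_add, mul_add, smul_add, hf, hf']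
      | hs t b => simp only [smul_single, single_mul_single, map_smul, mul_smul_comm]

end Cc

end Algebra

/-! ### Integrated forms and the reduced norm -/

section Integrated

variable {p : ℝ≥0∞} [Fact (1 ≤ p)] {G : Type v} {A : Type w} [Group G]
  [NonUnitalNormedRing A] [NormedSpace ℂ A] {α : IsometricAction G A} {E : Type*}
  [NormedAddCommGroup E] [NormedSpace ℂ E]

theorem regPi_add (π₀ : ContractiveRep A E) (a b : A) :
    regPi p α π₀ (a + b) = regPi p α π₀ a + regPi p α π₀ b := by
  ext ξ s
  simp [regPi_apply]

theorem regPi_smul (π₀ : ContractiveRep A E) (c : ℂ) (a : A) :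
    regPi p α π₀ (c • a) = c • regPi p α π₀ a := by
  ext ξ s
  simp [regPi_apply]

theorem regPi_mul (π₀ : ContractiveRep A E) (a b : A) :
    regPi p α π₀ (a * b) = regPi p α π₀ a * regPi p α π₀ b := by
  ext ξ s
  simp [regPi_apply]

theorem lam_mul (s t : G) : lam p E (s * t) = lam p E s * lam p E t := by
  ext ξ r
  simp [lam_apply, mul_assoc]

/-- Covariance of the regular representation. -/
theorem lam_mul_regPi (π₀ : ContractiveRep A E) (s : G) (a : A) :
    lam p E s * regPi p α π₀ a = regPi p α π₀ (α s a) * lam p E s := by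
  ext ξ t
  simp [lam_apply, regPi_apply, ← α.map_mul']

/-- The integrated form `π ⋊ λ` of the regular covariant representation `(π, λ)` associated with
`π₀`, `(π ⋊ λ)(f) = ∑_s π(f(s)) λ(s)`, on the algebra `C_c(G, A, α)`. -/
def integratedForm (π₀ : ContractiveRep A E) :
    Cc.{u, v, w} p α →ₙₐ[ℂ] (lpG p G E →L[ℂ] lpG p G E) where
  toFun f := ∑ s ∈ (Cc.toFinsupp f).support, regPi p α π₀ (Cc.toFinsupp f s) * lam p E s
  map_zero' := Finset.sum_empty
  map_add' f g := by
    let L : Cc.{u, v, w} p α →+ (lpG p G E →L[ℂ] lpG p G E) := Cc.sumHom fun s =>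
      AddMonoidHom.mk' (fun a => regPi p α π₀ a * lam p E s) fun a b => by rw [regPi_add, add_mul]
    change L (f + g) = L f + L g
    exact L.map_add f g
  map_smul' c f := by
    let L : Cc.{u, v, w} p α →+ (lpG p G E →L[ℂ] lpG p G E) := Cc.sumHom fun s =>
      AddMonoidHom.mk' (fun a => regPi p α π₀ a * lam p E s) fun a b => by rw [regPi_add, add_mul]
    change L (c • f) = c • L f
    induction f using Cc.induction with
    | h0 => simp
    | hadd f g hf hg => rw [smul_add, map_add, map_add, smul_add, hf, hg]
    | hs s a => simp [L, Cc.smul_single, Cc.sumHom_single, regPi_smul]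
  map_mul' f g := by
    let L : Cc.{u, v, w} p α →+ (lpG p G E →L[ℂ] lpG p G E) := Cc.sumHom fun s =>
      AddMonoidHom.mk' (fun a => regPi p α π₀ a * lam p E s) fun a b => by rw [regPi_add, add_mul]
    change L (f * g) = L f * L g
    induction f using Cc.induction with
    | h0 => simp
    | hadd f f' hf hf' => rw [add_mul, map_add, map_add, add_mul, hf, hf']
    | hs s a =>
      induction g using Cc.induction with
      | h0 => simp
      | hadd f f' hf hf' => rw [mul_add, map_add, map_add, mul_add, hf, hf']
      | hs t b =>
        simp only [L, Cc.single_mul_single, Cc.sumHom_single, AddMonoidHom.mk'_apply, regPi_mul,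
          lam_mul]
        rw [mul_assoc, ← mul_assoc (regPi p α π₀ (α s b)), ← lam_mul_regPi]
        simp only [mul_assoc]

theorem integratedForm_apply (π₀ : ContractiveRep A E) (f : Cc.{u, v, w} p α) :
    integratedForm π₀ f =
      ∑ s ∈ (Cc.toFinsupp f).support, regPi p α π₀ (Cc.toFinsupp f s) * lam p E s := rfl

theorem norm_integratedForm_le (π₀ : ContractiveRep A E) (f : Cc.{u, v, w} p α) :
    ‖integratedForm π₀ f‖ ≤ ∑ s ∈ (Cc.toFinsupp f).support, ‖Cc.toFinsupp f s‖ := by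
  rw [integratedForm_apply]
  refine (norm_sum_le _ _).trans (Finset.sum_le_sum fun s _ => ?_)
  calc _ ≤ ‖regPi p α π₀ (Cc.toFinsupp f s)‖ * ‖lam p E s‖ := norm_mul_le _ _
    _ ≤ ‖Cc.toFinsupp f s‖ * 1 :=
      mul_le_mul (norm_regPi_le p α π₀ _) (norm_lam_le p s) (norm_nonneg _) (norm_nonneg _)
    _ = _ := mul_one _

/-- The set of the numbers `‖(π ⋊ λ)(f)‖`, over the regular covariant representations associated
with all nondegenerate contractive representations of `A` on spaces `L^p(X, μ)`, `μ` `σ`-finite. -/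
def normSet (f : Cc.{u, v, w} p α) : Set ℝ :=
  {r | ∃ (X : Type u) (_ : MeasurableSpace X) (μ : Measure X) (_ : SigmaFinite μ)
    (π₀ : ContractiveRep A (Lp ℂ p μ)), π₀.Nondegenerate ∧ ‖integratedForm π₀ f‖ = r}

theorem normSet_bddAbove (f : Cc.{u, v, w} p α) : BddAbove (normSet f) := by
  refine ⟨∑ s ∈ (Cc.toFinsupp f).support, ‖Cc.toFinsupp f s‖, ?_⟩
  rintro _ ⟨X, _, μ, _, π₀, _, rfl⟩
  exact norm_integratedForm_le π₀ f

theorem normSet_nonempty (f : Cc.{u, v, w} p α) : (normSet f).Nonempty := by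
  refine ⟨_, PUnit, ⊤, 0, inferInstance, ContractiveRep.zero A _, ?_, rfl⟩
  have : Subsingleton (Lp ℂ p (0 : @Measure PUnit.{u + 1} ⊤)) :=
    ⟨fun f g => by ext1; simp [Filter.EventuallyEq]⟩
  intro x
  rw [Subsingleton.elim x 0]
  exact subset_closure (Submodule.zero_mem _)

/-- The norm of `F^p_λ(G, A, α)` on `C_c(G, A, α)`, a supremum over a nonempty bounded set. -/
def reducedNorm (f : Cc.{u, v, w} p α) : ℝ := sSup (normSet f)

theorem norm_le_reducedNorm (f : Cc.{u, v, w} p α) {X : Type u} [MeasurableSpace X]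
    (μ : Measure X) [SigmaFinite μ] (π₀ : ContractiveRep A (Lp ℂ p μ)) (h : π₀.Nondegenerate) :
    ‖integratedForm π₀ f‖ ≤ reducedNorm f :=
  le_csSup (normSet_bddAbove f) ⟨X, _, μ, inferInstance, π₀, h, rfl⟩

theorem reducedNorm_le (f : Cc.{u, v, w} p α) {C : ℝ}
    (hC : ∀ (X : Type u) [MeasurableSpace X] (μ : Measure X) [SigmaFinite μ]
      (π₀ : ContractiveRep A (Lp ℂ p μ)), π₀.Nondegenerate → ‖integratedForm π₀ f‖ ≤ C) :
    reducedNorm f ≤ C := by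
  refine csSup_le (normSet_nonempty f) ?_
  rintro _ ⟨X, _, μ, _, π₀, h, rfl⟩
  exact hC X μ π₀ h

theorem reducedNorm_nonneg (f : Cc.{u, v, w} p α) : 0 ≤ reducedNorm f := by
  obtain ⟨_, X, m, μ, hμ, π₀, h, rfl⟩ := normSet_nonempty f
  exact (norm_nonneg _).trans (norm_le_reducedNorm f μ π₀ h)

instance : NonUnitalSeminormedRing (Cc.{u, v, w} p α) where
  __ : SeminormedAddCommGroup (Cc.{u, v, w} p α) := AddGroupSeminorm.toSeminormedAddCommGroup
    { toFun := reducedNorm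
      map_zero' := le_antisymm (reducedNorm_le _ fun X _ μ _ π₀ _ => by simp)
        (reducedNorm_nonneg _)
      add_le' := fun f g => reducedNorm_le _ fun X _ μ _ π₀ h => by
        rw [map_add]
        exact (norm_add_le _ _).trans
          (add_le_add (norm_le_reducedNorm f μ π₀ h) (norm_le_reducedNorm g μ π₀ h))
      neg' := fun f => by
        have : normSet (-f) = normSet f := by
          simp only [normSet, map_neg, norm_neg]
        rw [reducedNorm, this, reducedNorm] }
  __ := (inferInstance : NonUnitalRing (Cc.{u, v, w} p α))
  norm_mul_le f g := reducedNorm_le _ fun X _ μ _ π₀ h => by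
    rw [map_mul]
    exact (norm_mul_le _ _).trans (mul_le_mul (norm_le_reducedNorm f μ π₀ h)
      (norm_le_reducedNorm g μ π₀ h) (norm_nonneg _) (reducedNorm_nonneg _))

theorem norm_def (f : Cc.{u, v, w} p α) : ‖f‖ = reducedNorm f := rfl

instance : NormedSpace ℂ (Cc.{u, v, w} p α) where
  norm_smul_le c f := reducedNorm_le _ fun X _ μ _ π₀ h => by
    rw [map_smul, norm_smul]
    exact mul_le_mul_of_nonneg_left (norm_le_reducedNorm f μ π₀ h) (norm_nonneg _)

end Integrated

/-! ### The reduced crossed product -/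

section Crossed

open UniformSpace

/-- The reduced `L^p` operator crossed product `F^p_λ(G, A, α)`: the completion of `C_c(G, A, α)`
in the reduced norm. -/
abbrev ReducedCrossedProduct.{a, b, c} (p : ℝ≥0∞) [Fact (1 ≤ p)] {G : Type b} {A : Type c}
    [Group G] [NonUnitalNormedRing A] [NormedSpace ℂ A] (α : IsometricAction.{b, c} G A) :
    Type (max b c) :=
  Completion (Cc.{a, b, c} p α)

variable {p : ℝ≥0∞} [Fact (1 ≤ p)] {G : Type v} {A : Type w} [Group G]
  [NonUnitalNormedRing A] [NormedSpace ℂ A] {α : IsometricAction G A}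

/-- The product of `F^p_λ(G, A, α)`: the continuous extension of twisted convolution. -/
instance : Mul (ReducedCrossedProduct.{u, v, w} p α) :=
  ⟨Function.curry <| (Completion.isDenseInducing_coe.prodMap
    Completion.isDenseInducing_coe).extend
      (fun x : Cc.{u, v, w} p α × Cc.{u, v, w} p α =>
        ((x.1 * x.2 : Cc.{u, v, w} p α) : ReducedCrossedProduct.{u, v, w} p α))⟩

theorem coe_mul (f g : Cc.{u, v, w} p α) :
    ((f * g : Cc.{u, v, w} p α) : ReducedCrossedProduct.{u, v, w} p α) = f * g :=
  ((Completion.isDenseInducing_coe.prodMap Completion.isDenseInducing_coe).extend_eq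
    ((Completion.continuous_coe _).comp continuous_mul) (f, g)).symm

instance : ContinuousMul (ReducedCrossedProduct.{u, v, w} p α) where
  continuous_mul := by
    let m := (AddMonoidHom.mul : Cc.{u, v, w} p α →+ Cc.{u, v, w} p α →+ Cc.{u, v, w} p α).compr₂
      Completion.toCompl
    have : Continuous fun x : Cc.{u, v, w} p α × Cc.{u, v, w} p α => m x.1 x.2 :=
      (Completion.continuous_coe _).comp continuous_mul
    have di : IsDenseInducing
        (Completion.toCompl : Cc.{u, v, w} p α → ReducedCrossedProduct.{u, v, w} p α) :=
      Completion.isDenseInducing_coe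
    exact (di.extend_Z_bilin di this :)

instance : NonUnitalNormedRing (ReducedCrossedProduct.{u, v, w} p α) where
  __ := (inferInstance : NormedAddCommGroup (ReducedCrossedProduct.{u, v, w} p α))
  __ := (inferInstance : Mul (ReducedCrossedProduct.{u, v, w} p α))
  zero_mul x := by
    induction x using Completion.induction_on with
    | hp => exact isClosed_eq (by fun_prop) (by fun_prop)
    | ih f => rw [← Completion.coe_zero, ← coe_mul, zero_mul]
  mul_zero x := by
    induction x using Completion.induction_on with
    | hp => exact isClosed_eq (by fun_prop) (by fun_prop)
    | ih f => rw [← Completion.coe_zero, ← coe_mul, mul_zero]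
  mul_assoc x y z :=
    Completion.induction_on₃ x y z (isClosed_eq (by fun_prop) (by fun_prop)) fun f g h => by
      rw [← coe_mul, ← coe_mul, ← coe_mul, ← coe_mul, mul_assoc]
  left_distrib x y z :=
    Completion.induction_on₃ x y z (isClosed_eq (by fun_prop) (by fun_prop)) fun f g h => by
      rw [← Completion.coe_add, ← coe_mul, ← coe_mul, ← coe_mul, ← Completion.coe_add, mul_add]
  right_distrib x y z :=
    Completion.induction_on₃ x y z (isClosed_eq (by fun_prop) (by fun_prop)) fun f g h => by
      rw [← Completion.coe_add, ← coe_mul, ← coe_mul, ← coe_mul, ← Completion.coe_add, add_mul]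
  norm_mul_le x y :=
    Completion.induction_on₂ x y (isClosed_le (by fun_prop) (by fun_prop)) fun f g => by
      rw [← coe_mul, Completion.norm_coe, Completion.norm_coe, Completion.norm_coe]
      exact norm_mul_le f g

instance [IsScalarTower ℂ A A] :
    IsScalarTower ℂ (ReducedCrossedProduct.{u, v, w} p α) (ReducedCrossedProduct.{u, v, w} p α) where
  smul_assoc c x y := by
    simp only [smul_eq_mul]
    exact Completion.induction_on₂ x y
      (isClosed_eq (((continuous_const_smul c).comp continuous_fst).mul continuous_snd)
        ((continuous_const_smul c).comp (continuous_fst.mul continuous_snd))) fun f g => by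
      rw [← Completion.coe_smul, ← coe_mul, ← coe_mul, ← Completion.coe_smul, smul_mul_assoc]

instance [SMulCommClass ℂ A A] :
    SMulCommClass ℂ (ReducedCrossedProduct.{u, v, w} p α) (ReducedCrossedProduct.{u, v, w} p α) where
  smul_comm c x y := by
    simp only [smul_eq_mul]
    exact Completion.induction_on₂ x y
      (isClosed_eq ((continuous_const_smul c).comp (continuous_fst.mul continuous_snd))
        (continuous_fst.mul ((continuous_const_smul c).comp continuous_snd))) fun f g => by
      rw [← Completion.coe_smul, ← coe_mul, ← coe_mul, ← Completion.coe_smul, mul_smul_comm]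

end Crossed

end LpCrossed

end

/-!
The reduced norm is a supremum over all nondegenerate contractive representations, so one has to
show that `‖(σ ⋊ λ)(f)‖ ≤ ‖(π ⋊ λ)(f)‖` when `π` is isometric and `σ` is contractive. An operator on
`ℓ^p(G, E)` with `p < ∞` is approximated strongly by its compressions to finite subsets of `G`, and
the compressions of `(σ ⋊ λ)(f)` are matrices over `σ(A)` whose entries in `A` depend on `f` only; it
therefore suffices to compare matrix norms. If the spaces are separable, `π ⊕ σ` is again an
isometric representation on an `L^p` space, whose matrix norms agree with those of `π` by uniqueness
and dominate those of `σ`. The `σ`-finite case follows because `A` is separable: any countable set of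
vectors lies in the `L^p` space of an invariant countably generated sub-`σ`-algebra, and countably
many vectors suffice to make the restriction of `π` isometric.
-/

noncomputable section

namespace LpCrossed

theorem exponent_toReal_pos {p : ℝ≥0∞} [Fact (1 ≤ p)] (hp : p ≠ ∞) : 0 < p.toReal :=
  ENNReal.toReal_pos (ne_zero_of_fact p) hp

/-! ### Finite sections of operators on `ℓ^p` spaces -/

section FiniteSections

variable {p : ℝ≥0∞} [Fact (1 ≤ p)] {ι κ : Type*} {E F : Type*}
  [NormedAddCommGroup E] [NormedSpace ℂ E] [NormedAddCommGroup F] [NormedSpace ℂ F]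

/-- Restriction along `e`, as an operator `ℓ^p(ι, E) → ℓ^p(κ, E)`. -/
def lpRestrict (e : κ ↪ ι) : lp (fun _ : ι => E) p →L[ℂ] PiLp p (fun _ : κ => E) :=
  ((PiLp.continuousLinearEquiv p ℂ fun _ : κ => E).symm :
      (κ → E) →L[ℂ] PiLp p (fun _ : κ => E)) ∘L
    ContinuousLinearMap.pi fun j => lp.evalCLM ℂ (fun _ => E) p (e j)

theorem lpRestrict_apply (e : κ ↪ ι) (ξ : lp (fun _ : ι => E) p) (j : κ) :
    lpRestrict e ξ j = ξ (e j) := rfl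

variable [Fintype κ]

open Classical in
/-- Extension by zero of a finite family along `e`, as an operator `ℓ^p(κ, E) → ℓ^p(ι, E)`. -/
def lpExtend (e : κ ↪ ι) : PiLp p (fun _ : κ => E) →L[ℂ] lp (fun _ : ι => E) p :=
  ∑ j, lp.singleContinuousLinearMap ℂ (fun _ => E) p (e j) ∘L PiLp.proj p _ j

open Classical in
theorem lpExtend_apply (e : κ ↪ ι) (x : PiLp p fun _ : κ => E) :
    lpExtend e x = ∑ j, lp.single p (e j) (x j) := by
  simp [lpExtend]

omit [NormedSpace ℂ E] in
theorem norm_piLp_rpow_eq_sum (hp : p ≠ ∞) (x : PiLp p fun _ : κ => E) :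
    ‖x‖ ^ p.toReal = ∑ j, ‖x j‖ ^ p.toReal := by
  have hp' := exponent_toReal_pos hp
  rw [PiLp.norm_eq_sum hp', one_div, Real.rpow_inv_rpow (by positivity) hp'.ne']

theorem norm_lpExtend (hp : p ≠ ∞) (e : κ ↪ ι) (x : PiLp p fun _ : κ => E) :
    ‖lpExtend e x‖ = ‖x‖ := by
  classical
  have hp' := exponent_toReal_pos hp
  have hx : lpExtend e x =
      ∑ i ∈ Finset.univ.map e, lp.single p i (Function.extend e x 0 i) := by
    simp [lpExtend_apply, e.injective.extend_apply]
  rw [← Real.rpow_left_inj (norm_nonneg _) (norm_nonneg _) hp'.ne', hx,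
    lp.norm_sum_single hp', norm_piLp_rpow_eq_sum hp, Finset.sum_map]
  simp only [e.injective.extend_apply]

theorem norm_lpRestrict_le (hp : p ≠ ∞) (e : κ ↪ ι) (ξ : lp (fun _ : ι => E) p) :
    ‖lpRestrict e ξ‖ ≤ ‖ξ‖ := by
  have hp' := exponent_toReal_pos hp
  rw [← Real.rpow_le_rpow_iff (norm_nonneg _) (norm_nonneg _) hp', norm_piLp_rpow_eq_sum hp]
  simpa only [Finset.sum_map, lpRestrict_apply] using
    lp.sum_rpow_le_norm_rpow hp' ξ (Finset.univ.map e)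

open Classical in
theorem lpExtend_lpRestrict (e : κ ↪ ι) (ξ : lp (fun _ : ι => E) p) :
    lpExtend e (lpRestrict e ξ) = ∑ i ∈ Finset.univ.map e, lp.single p i (ξ i) := by
  simp [lpExtend_apply, lpRestrict_apply]

theorem exists_embedding_map_univ_eq (S : Finset ι) :
    ∃ (n : ℕ) (e : Fin n ↪ ι), Finset.univ.map e = S :=
  ⟨S.card, S.equivFin.symm.toEmbedding.trans (Function.Embedding.subtype _), by
    rw [← Finset.map_map, Finset.map_univ_equiv, Finset.univ_eq_attach, Finset.attach_map_val]⟩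

theorem norm_section_le (hp : p ≠ ∞) (T : lp (fun _ : ι => E) p →L[ℂ] lp (fun _ : ι => F) p)
    (e : κ ↪ ι) : ‖lpRestrict e ∘L T ∘L lpExtend e‖ ≤ ‖T‖ :=
  ContinuousLinearMap.opNorm_le_bound _ (norm_nonneg _) fun x => calc
    ‖lpRestrict e (T (lpExtend e x))‖ ≤ ‖T (lpExtend e x)‖ := norm_lpRestrict_le hp e _
    _ ≤ ‖T‖ * ‖x‖ := norm_lpExtend hp e x ▸ T.le_opNorm _

theorem norm_lpRestrict_apply_le (hp : p ≠ ∞)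
    (T : lp (fun _ : ι => E) p →L[ℂ] lp (fun _ : ι => F) p) (e : κ ↪ ι)
    (ξ : lp (fun _ : ι => E) p) :
    ‖lpRestrict e (T ξ)‖ ≤
      ‖lpRestrict e ∘L T ∘L lpExtend e‖ * ‖ξ‖ + ‖T‖ * ‖ξ - lpExtend e (lpRestrict e ξ)‖ := by
  have hsection : ‖lpRestrict e (T (lpExtend e (lpRestrict e ξ)))‖ ≤
      ‖lpRestrict e ∘L T ∘L lpExtend e‖ * ‖ξ‖ :=
    ((lpRestrict e ∘L T ∘L lpExtend e).le_opNorm (lpRestrict e ξ)).trans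
      (mul_le_mul_of_nonneg_left (norm_lpRestrict_le hp e ξ) (norm_nonneg _))
  have hrest : ‖lpRestrict e (T (ξ - lpExtend e (lpRestrict e ξ)))‖ ≤
      ‖T‖ * ‖ξ - lpExtend e (lpRestrict e ξ)‖ :=
    (norm_lpRestrict_le hp e _).trans (T.le_opNorm _)
  have hsplit : lpRestrict e (T ξ) = lpRestrict e (T (lpExtend e (lpRestrict e ξ))) +
      lpRestrict e (T (ξ - lpExtend e (lpRestrict e ξ))) := by
    rw [← map_add, ← map_add, add_sub_cancel]
  exact hsplit ▸ norm_add_le_of_le hsection hrest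

theorem opNorm_le_of_section_le (hp : p ≠ ∞)
    (T : lp (fun _ : ι => E) p →L[ℂ] lp (fun _ : ι => F) p) {C : ℝ} (hC : 0 ≤ C)
    (h : ∀ (n : ℕ) (e : Fin n ↪ ι), ‖lpRestrict e ∘L T ∘L lpExtend e‖ ≤ C) : ‖T‖ ≤ C := by
  classical
  refine ContinuousLinearMap.opNorm_le_bound _ hC fun ξ => ?_
  have hξ : Filter.Tendsto (fun S : Finset ι => ∑ i ∈ S, lp.single p i (ξ i)) Filter.atTop
      (nhds ξ) := lp.hasSum_single hp ξ
  have hTξ : Filter.Tendsto (fun S : Finset ι => ‖∑ i ∈ S, lp.single p i (T ξ i)‖) Filter.atTop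
      (nhds ‖T ξ‖) := (lp.hasSum_single hp (T ξ)).norm
  have hlim : Filter.Tendsto
      (fun S : Finset ι => C * ‖ξ‖ + ‖T‖ * ‖ξ - ∑ i ∈ S, lp.single p i (ξ i)‖) Filter.atTop
      (nhds (C * ‖ξ‖)) := by
    simpa using (((tendsto_const_nhds (x := ξ)).sub hξ).norm.const_mul ‖T‖).const_add (C * ‖ξ‖)
  refine le_of_tendsto_of_tendsto' hTξ hlim fun S => ?_
  obtain ⟨n, e, rfl⟩ := exists_embedding_map_univ_eq S
  rw [← lpExtend_lpRestrict, ← lpExtend_lpRestrict, norm_lpExtend hp]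
  refine (norm_lpRestrict_apply_le hp T e ξ).trans ?_
  gcongr
  exact h n e

end FiniteSections

section SectionMatrix

variable {p : ℝ≥0∞} [Fact (1 ≤ p)] {G : Type v} {A : Type w} [Group G]
  [NonUnitalNormedRing A] [NormedSpace ℂ A] {α : IsometricAction G A} {E F : Type*}
  [NormedAddCommGroup E] [NormedSpace ℂ E] [NormedAddCommGroup F] [NormedSpace ℂ F]

/-- The matrix over `A` of the operators `(π ⋊ λ)(f)` on the points `e i` of `G`; it does not depend
on the representation. -/
def sectionMatrix (f : Cc.{u, v, w} p α) {n : ℕ} (e : Fin n ↪ G) : Matrix (Fin n) (Fin n) A :=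
  Matrix.of fun i j => α (e i)⁻¹ (Cc.toFinsupp f (e i * (e j)⁻¹))

theorem integratedForm_apply_apply (π : ContractiveRep A E) (f : Cc.{u, v, w} p α)
    (ξ : lpG p G E) (s : G) :
    integratedForm π f ξ s =
      ∑ r ∈ (Cc.toFinsupp f).support, π.hom (α s⁻¹ (Cc.toFinsupp f r)) (ξ (r⁻¹ * s)) := by
  rw [integratedForm_apply, sum_apply, lp.coeFn_sum, Finset.sum_apply]
  rfl

open Classical in
theorem integratedForm_single_apply (π : ContractiveRep A E) (f : Cc.{u, v, w} p α)
    (s t : G) (x : E) :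
    integratedForm π f (lp.single p t x) s = π.hom (α s⁻¹ (Cc.toFinsupp f (s * t⁻¹))) x := by
  rw [integratedForm_apply_apply, Finset.sum_eq_single (s * t⁻¹)]
  · simp
  · intro r _ hr
    have hrt : r⁻¹ * s ≠ t := fun h => hr (by rw [← h]; group)
    rw [lp.single_apply_ne _ _ _ hrt, map_zero]
  · intro hst
    simp [Finsupp.notMem_support_iff.1 hst]

theorem amplify_sectionMatrix (π : ContractiveRep A E) (f : Cc.{u, v, w} p α) {n : ℕ}
    (e : Fin n ↪ G) :
    amplify p π (sectionMatrix f e) = lpRestrict e ∘L integratedForm π f ∘L lpExtend e := by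
  classical
  ext x i
  rw [amplify_apply, ContinuousLinearMap.comp_apply, ContinuousLinearMap.comp_apply,
    lpRestrict_apply, lpExtend_apply, map_sum, lp.coeFn_sum, Finset.sum_apply]
  simp only [integratedForm_single_apply, sectionMatrix, Matrix.of_apply]

theorem norm_integratedForm_mono (hp : p ≠ ∞) {π : ContractiveRep A E} {σ : ContractiveRep A F}
    (h : ∀ (n : ℕ) (a : Matrix (Fin n) (Fin n) A), ‖amplify p σ a‖ ≤ ‖amplify p π a‖)
    (f : Cc.{u, v, w} p α) : ‖integratedForm σ f‖ ≤ ‖integratedForm π f‖ := by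
  refine opNorm_le_of_section_le hp _ (norm_nonneg _) fun n e => ?_
  rw [← amplify_sectionMatrix]
  calc ‖amplify p σ (sectionMatrix f e)‖ ≤ ‖amplify p π (sectionMatrix f e)‖ := h n _
    _ ≤ ‖integratedForm π f‖ := amplify_sectionMatrix π f e ▸ norm_section_le hp _ e

end SectionMatrix

/-! ### Subrepresentations and direct sums -/

section Intertwining

variable {p : ℝ≥0∞} [Fact (1 ≤ p)] {A : Type w} [NonUnitalNormedRing A] [NormedSpace ℂ A]
  {E F : Type*} [NormedAddCommGroup E] [NormedSpace ℂ E] [NormedAddCommGroup F] [NormedSpace ℂ F]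

/-- The diagonal map `(x_j)_j ↦ (V x_j)_j` on `ℓ^p` direct sums of copies of `E`. -/
def piLpMap (p : ℝ≥0∞) [Fact (1 ≤ p)] {κ : Type*} [Fintype κ] (V : E →ₗᵢ[ℂ] F) :
    PiLp p (fun _ : κ => E) →ₗᵢ[ℂ] PiLp p (fun _ : κ => F) where
  toFun x := WithLp.toLp p fun j => V (x j)
  map_add' x y := by ext j; exact map_add V _ _
  map_smul' c x := by ext j; exact map_smul V _ _
  norm_map' x := by
    change ‖WithLp.toLp p fun j => V (x j)‖ = ‖x‖
    obtain rfl | hp := p.dichotomy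
    · simp only [PiLp.norm_eq_ciSup, V.norm_map]
    · simp only [PiLp.norm_eq_sum (zero_lt_one.trans_le hp), V.norm_map]

theorem piLpMap_apply {κ : Type*} [Fintype κ] (V : E →ₗᵢ[ℂ] F) (x : PiLp p fun _ : κ => E)
    (j : κ) : piLpMap p V x j = V (x j) := rfl

/-- `V` identifies `π` with the restriction of `σ` to the range of `V`. -/
def Intertwines (V : E →ₗᵢ[ℂ] F) (π : ContractiveRep A E) (σ : ContractiveRep A F) : Prop :=
  ∀ a x, V (π.hom a x) = σ.hom a (V x)

namespace Intertwines

variable {V : E →ₗᵢ[ℂ] F} {π : ContractiveRep A E} {σ : ContractiveRep A F}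

theorem symm {e : E ≃ₗᵢ[ℂ] F} (h : Intertwines e.toLinearIsometry π σ) :
    Intertwines e.symm.toLinearIsometry σ π := fun a y => e.injective <| by
  have hy := h a (e.symm y)
  simp only [LinearIsometryEquiv.coe_toLinearIsometry, e.apply_symm_apply] at hy ⊢
  exact hy.symm

theorem isIsometric (h : Intertwines V π σ) (hπ : π.IsIsometric) : σ.IsIsometric := fun a => by
  refine (σ.norm_le a).antisymm ?_
  rw [← hπ a]
  refine ContinuousLinearMap.opNorm_le_bound _ (norm_nonneg _) fun x => ?_
  rw [← V.norm_map, h, ← V.norm_map x]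
  exact (σ.hom a).le_opNorm _

theorem piLpMap_amplify (h : Intertwines V π σ) {n : ℕ} (a : Matrix (Fin n) (Fin n) A)
    (x : PiLp p fun _ : Fin n => E) :
    piLpMap p V (amplify p π a x) = amplify p σ a (piLpMap p V x) := by
  ext i
  simp only [piLpMap_apply, amplify_apply, map_sum, h _ _]

theorem norm_amplify_le (h : Intertwines V π σ) {n : ℕ} (a : Matrix (Fin n) (Fin n) A) :
    ‖amplify p π a‖ ≤ ‖amplify p σ a‖ := by
  refine ContinuousLinearMap.opNorm_le_bound _ (norm_nonneg _) fun x => ?_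
  rw [← (piLpMap p V).norm_map, h.piLpMap_amplify, ← (piLpMap p V).norm_map x]
  exact (amplify p σ a).le_opNorm _

end Intertwines

omit [NormedSpace ℂ E] [NormedSpace ℂ F] in
theorem norm_toLp_prod_le {z : WithLp p (E × F)} {x : E} {y : F} {c : ℝ} (hc : 0 ≤ c)
    (hx : ‖x‖ ≤ c * ‖z.fst‖) (hy : ‖y‖ ≤ c * ‖z.snd‖) : ‖WithLp.toLp p (x, y)‖ ≤ c * ‖z‖ := by
  obtain rfl | hp := p.dichotomy
  · rw [WithLp.prod_norm_eq_sup, WithLp.prod_norm_eq_sup, mul_max_of_nonneg _ _ hc]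
    exact max_le_max hx hy
  · have hp₀ : 0 < p.toReal := zero_lt_one.trans_le hp
    have hpow {r s : ℝ} (hr : 0 ≤ r) (hs : 0 ≤ s) (h : r ≤ c * s) :
        r ^ p.toReal ≤ c ^ p.toReal * s ^ p.toReal := by
      rw [← Real.mul_rpow hc hs]
      exact Real.rpow_le_rpow hr h hp₀.le
    rw [← Real.rpow_le_rpow_iff (norm_nonneg _) (by positivity) hp₀,
      Real.mul_rpow hc (norm_nonneg _), WithLp.prod_norm_eq_add hp₀, WithLp.prod_norm_eq_add hp₀,
      ← Real.rpow_mul (by positivity), ← Real.rpow_mul (by positivity),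
      one_div_mul_cancel hp₀.ne', Real.rpow_one, Real.rpow_one, mul_add]
    exact add_le_add (hpow (norm_nonneg _) (norm_nonneg _) hx)
      (hpow (norm_nonneg _) (norm_nonneg _) hy)

namespace ContractiveRep

theorem continuous_hom (π : ContractiveRep A E) : Continuous π.hom :=
  AddMonoidHomClass.continuous_of_bound π.hom 1 fun a => by simpa using π.norm_le a

/-- The subrepresentation of `π` on the range of `V`, transported to the domain of `V`. -/
def restrict (π : ContractiveRep A E) (V : F →ₗᵢ[ℂ] E)
    (h : ∀ a x, π.hom a (V x) ∈ LinearMap.range V.toLinearMap) : ContractiveRep A F :=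
  let T (a : A) : F →L[ℂ] F := (V.equivRange.symm : _ →L[ℂ] F) ∘L
    ((π.hom a) ∘L V.toContinuousLinearMap).codRestrict (LinearMap.range V.toLinearMap) (h a)
  have hT (a : A) (x : F) : V (T a x) = π.hom a (V x) :=
    congrArg Subtype.val (V.equivRange.apply_symm_apply ⟨π.hom a (V x), h a x⟩)
  { hom :=
      { toFun := T
        map_smul' := fun c a => by ext x; exact V.injective (by simp [hT])
        map_zero' := by ext x; exact V.injective (by simp [hT])
        map_add' := fun a b => by ext x; exact V.injective (by simp [hT])
        map_mul' := fun a b => by ext x; exact V.injective (by simp [hT]) }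
    norm_le := fun a => ContinuousLinearMap.opNorm_le_bound _ (norm_nonneg _) fun x => by
      change ‖T a x‖ ≤ _
      rw [← V.norm_map, hT, ← V.norm_map x]
      exact (π.hom a).le_of_opNorm_le (π.norm_le a) _ }

theorem intertwines_restrict (π : ContractiveRep A E) (V : F →ₗᵢ[ℂ] E)
    (h : ∀ a x, π.hom a (V x) ∈ LinearMap.range V.toLinearMap) :
    Intertwines V (π.restrict V h) π := fun a x =>
  congrArg Subtype.val (V.equivRange.apply_symm_apply ⟨π.hom a (V x), h a x⟩)

variable (p) in
/-- The `ℓ^p` direct sum of two representations. -/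
def prod (π : ContractiveRep A E) (σ : ContractiveRep A F) :
    ContractiveRep A (WithLp p (E × F)) where
  hom :=
    { toFun := fun a => ((WithLp.prodContinuousLinearEquiv p ℂ E F).symm :
          E × F →L[ℂ] WithLp p (E × F)) ∘L (π.hom a).prodMap (σ.hom a) ∘L
        (WithLp.prodContinuousLinearEquiv p ℂ E F : WithLp p (E × F) →L[ℂ] E × F)
      map_smul' := fun c a => by rw [map_smul, map_smul]; rfl
      map_zero' := by rw [map_zero, map_zero]; rfl
      map_add' := fun a b => by rw [map_add, map_add]; rfl
      map_mul' := fun a b => by rw [map_mul, map_mul]; rfl }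
  norm_le a := ContinuousLinearMap.opNorm_le_bound _ (norm_nonneg _) fun z =>
    norm_toLp_prod_le (norm_nonneg a) ((π.hom a).le_of_opNorm_le (π.norm_le a) z.fst)
      ((σ.hom a).le_of_opNorm_le (σ.norm_le a) z.snd)

variable (p E F) in
/-- The inclusion of the first summand of `E ⊕_p F`. -/
def prodInl : E →ₗᵢ[ℂ] WithLp p (E × F) where
  toLinearMap := (WithLp.linearEquiv p ℂ (E × F)).symm.toLinearMap ∘ₗ LinearMap.inl ℂ E F
  norm_map' := WithLp.norm_toLp_fst p E F

variable (p E F) in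
/-- The inclusion of the second summand of `E ⊕_p F`. -/
def prodInr : F →ₗᵢ[ℂ] WithLp p (E × F) where
  toLinearMap := (WithLp.linearEquiv p ℂ (E × F)).symm.toLinearMap ∘ₗ LinearMap.inr ℂ E F
  norm_map' := WithLp.norm_toLp_snd p E F

theorem intertwines_prodInl (π : ContractiveRep A E) (σ : ContractiveRep A F) :
    Intertwines (prodInl p E F) π (prod p π σ) := fun a _ =>
  congrArg (WithLp.toLp p) (Prod.ext rfl (map_zero (σ.hom a)).symm)

theorem intertwines_prodInr (π : ContractiveRep A E) (σ : ContractiveRep A F) :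
    Intertwines (prodInr p E F) σ (prod p π σ) := fun a _ =>
  congrArg (WithLp.toLp p) (Prod.ext (map_zero (π.hom a)).symm rfl)

end ContractiveRep

end Intertwining

/-! ### `L^p` spaces of disjoint unions -/

section Sum

variable {X Y : Type*} [MeasurableSpace X] [MeasurableSpace Y]

theorem measurableEmbedding_inl : MeasurableEmbedding (Sum.inl : X → X ⊕ Y) :=
  ⟨Sum.inl_injective, measurable_inl, fun _ hs => hs.inl_image⟩

theorem measurableEmbedding_inr : MeasurableEmbedding (Sum.inr : Y → X ⊕ Y) :=
  ⟨Sum.inr_injective, measurable_inr, fun _ hs => hs.inr_image⟩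

/-- The measure on the disjoint union `X ⊕ Y` that restricts to `μ` on `X` and to `ν` on `Y`. -/
def sumMeasure (μ : Measure X) (ν : Measure Y) : Measure (X ⊕ Y) :=
  μ.map Sum.inl + ν.map Sum.inr

variable {μ : Measure X} {ν : Measure Y}

instance [SigmaFinite μ] [SigmaFinite ν] : SigmaFinite (sumMeasure μ ν) := by
  have := measurableEmbedding_inl.sigmaFinite_map (μ := μ) (f := (Sum.inl : X → X ⊕ Y))
  have := measurableEmbedding_inr.sigmaFinite_map (μ := ν) (f := (Sum.inr : Y → X ⊕ Y))
  exact inferInstanceAs (SigmaFinite (μ.map Sum.inl + ν.map Sum.inr))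

theorem ae_sumMeasure_iff {P : X ⊕ Y → Prop} :
    (∀ᵐ z ∂sumMeasure μ ν, P z) ↔ (∀ᵐ x ∂μ, P (Sum.inl x)) ∧ ∀ᵐ y ∂ν, P (Sum.inr y) := by
  rw [sumMeasure, ae_add_measure_iff, measurableEmbedding_inl.ae_map_iff,
    measurableEmbedding_inr.ae_map_iff]

theorem lintegral_sumMeasure (f : X ⊕ Y → ℝ≥0∞) :
    ∫⁻ z, f z ∂sumMeasure μ ν = ∫⁻ x, f (Sum.inl x) ∂μ + ∫⁻ y, f (Sum.inr y) ∂ν := by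
  rw [sumMeasure, lintegral_add_measure, measurableEmbedding_inl.lintegral_map,
    measurableEmbedding_inr.lintegral_map]

theorem aestronglyMeasurable_sumMeasure_iff {Z : Type*} [TopologicalSpace Z]
    [TopologicalSpace.PseudoMetrizableSpace Z] {f : X ⊕ Y → Z} :
    AEStronglyMeasurable f (sumMeasure μ ν) ↔
      AEStronglyMeasurable (f ∘ Sum.inl) μ ∧ AEStronglyMeasurable (f ∘ Sum.inr) ν := by
  rw [sumMeasure, aestronglyMeasurable_add_measure_iff,
    measurableEmbedding_inl.aestronglyMeasurable_map_iff,
    measurableEmbedding_inr.aestronglyMeasurable_map_iff]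

variable {p : ℝ≥0∞} {E : Type*} [NormedAddCommGroup E]

theorem eLpNorm_rpow_sumMeasure (h₀ : p ≠ 0) (hp : p ≠ ∞) (f : X ⊕ Y → E) :
    eLpNorm f p (sumMeasure μ ν) ^ p.toReal =
      eLpNorm (f ∘ Sum.inl) p μ ^ p.toReal + eLpNorm (f ∘ Sum.inr) p ν ^ p.toReal := by
  have hp' := ENNReal.toReal_pos h₀ hp
  simp only [eLpNorm_eq_lintegral_rpow_enorm_toReal h₀ hp, ← ENNReal.rpow_mul,
    one_div_mul_cancel hp'.ne', ENNReal.rpow_one, lintegral_sumMeasure, Function.comp]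

theorem memLp_sumMeasure_iff (h₀ : p ≠ 0) (hp : p ≠ ∞) {f : X ⊕ Y → E} :
    MemLp f p (sumMeasure μ ν) ↔ MemLp (f ∘ Sum.inl) p μ ∧ MemLp (f ∘ Sum.inr) p ν := by
  have hp' := ENNReal.toReal_pos h₀ hp
  have hfin : eLpNorm f p (sumMeasure μ ν) < ∞ ↔
      eLpNorm (f ∘ Sum.inl) p μ < ∞ ∧ eLpNorm (f ∘ Sum.inr) p ν < ∞ := by
    rw [← ENNReal.rpow_lt_top_iff_of_pos hp', eLpNorm_rpow_sumMeasure h₀ hp, ENNReal.add_lt_top,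
      ENNReal.rpow_lt_top_iff_of_pos hp', ENNReal.rpow_lt_top_iff_of_pos hp']
  rw [MemLp, aestronglyMeasurable_sumMeasure_iff, hfin, MemLp, MemLp]
  tauto

variable [Fact (1 ≤ p)]

theorem memLp_comp_inl (hp : p ≠ ∞) (f : Lp E p (sumMeasure μ ν)) :
    MemLp (f ∘ Sum.inl) p μ :=
  ((memLp_sumMeasure_iff (ne_zero_of_fact p) hp).1 (Lp.memLp f)).1

theorem memLp_comp_inr (hp : p ≠ ∞) (f : Lp E p (sumMeasure μ ν)) :
    MemLp (f ∘ Sum.inr) p ν :=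
  ((memLp_sumMeasure_iff (ne_zero_of_fact p) hp).1 (Lp.memLp f)).2

theorem norm_lp_sumMeasure (hp : p ≠ ∞) (f : Lp E p (sumMeasure μ ν)) :
    ‖WithLp.toLp p ((memLp_comp_inl hp f).toLp _, (memLp_comp_inr hp f).toLp _)‖ = ‖f‖ := by
  have hp₀ := exponent_toReal_pos hp
  have hpow := congrArg ENNReal.toReal
    (eLpNorm_rpow_sumMeasure (μ := μ) (ν := ν) (ne_zero_of_fact p) hp f)
  rw [ENNReal.toReal_add (by simp [(memLp_comp_inl hp f).2.ne])
    (by simp [(memLp_comp_inr hp f).2.ne])] at hpow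
  simp only [← ENNReal.toReal_rpow] at hpow
  rw [← Real.rpow_left_inj (norm_nonneg _) (norm_nonneg _) hp₀.ne', Lp.norm_def f, hpow,
    WithLp.prod_norm_eq_add hp₀, ← Real.rpow_mul (by positivity), one_div_mul_cancel hp₀.ne',
    Real.rpow_one]
  exact congrArg₂ (· ^ p.toReal + · ^ p.toReal)
    (Lp.norm_toLp _ (memLp_comp_inl hp f)) (Lp.norm_toLp _ (memLp_comp_inr hp f))

variable (E μ ν) in
/-- The isometric isomorphism of `L^p(X ⊕ Y)` with the `ℓ^p` direct sum of `L^p(X)` and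
`L^p(Y)`. -/
def lpSumIsometry (𝕜 : Type*) [NormedField 𝕜] [NormedSpace 𝕜 E] (hp : p ≠ ∞) :
    Lp E p (sumMeasure μ ν) ≃ₗᵢ[𝕜] WithLp p (Lp E p μ × Lp E p ν) :=
  LinearIsometryEquiv.ofSurjective
    { toFun := fun f =>
        WithLp.toLp p ((memLp_comp_inl hp f).toLp _, (memLp_comp_inr hp f).toLp _)
      map_add' := fun f g => by
        have h := ae_sumMeasure_iff.1 (Lp.coeFn_add f g)
        exact congrArg (WithLp.toLp p) (Prod.ext
          (MemLp.toLp_congr (memLp_comp_inl hp (f + g))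
            ((memLp_comp_inl hp f).add (memLp_comp_inl hp g)) h.1)
          (MemLp.toLp_congr (memLp_comp_inr hp (f + g))
            ((memLp_comp_inr hp f).add (memLp_comp_inr hp g)) h.2))
      map_smul' := fun c f => by
        have h := ae_sumMeasure_iff.1 (Lp.coeFn_smul c f)
        exact congrArg (WithLp.toLp p) (Prod.ext
          (MemLp.toLp_congr (memLp_comp_inl hp (c • f)) ((memLp_comp_inl hp f).const_smul c) h.1)
          (MemLp.toLp_congr (memLp_comp_inr hp (c • f)) ((memLp_comp_inr hp f).const_smul c) h.2))
      norm_map' := norm_lp_sumMeasure hp }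
    fun z => by
      have hz : MemLp (Sum.elim z.fst z.snd) p (sumMeasure μ ν) :=
        (memLp_sumMeasure_iff (ne_zero_of_fact p) hp).2 ⟨Lp.memLp z.fst, Lp.memLp z.snd⟩
      have h := ae_sumMeasure_iff.1 hz.coeFn_toLp
      exact ⟨hz.toLp _, congrArg (WithLp.toLp p) (Prod.ext
        (Lp.ext ((memLp_comp_inl hp _).coeFn_toLp.trans h.1))
        (Lp.ext ((memLp_comp_inr hp _).coeFn_toLp.trans h.2)))⟩

end Sum

section Domination

variable {p : ℝ≥0∞} [Fact (1 ≤ p)] {A : Type w} [NonUnitalNormedRing A] [NormedSpace ℂ A]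

/-- The direct sum `π ⊕ σ` is isometric and contains both `π` and `σ`, so uniqueness of the matrix
norms, applied to `π` and `π ⊕ σ`, bounds those of `σ` although `σ` need not be isometric. -/
theorem norm_amplify_le_of_separable (hp : p ≠ ∞) (hunique : HasUniqueLpMatrixNorms.{u, w} p A)
    {X Y : Type u} [MeasurableSpace X] [MeasurableSpace Y] {μ : Measure X} {ν : Measure Y}
    [SigmaFinite μ] [SigmaFinite ν] [TopologicalSpace.SeparableSpace (Lp ℂ p μ)]
    [TopologicalSpace.SeparableSpace (Lp ℂ p ν)] {π : ContractiveRep A (Lp ℂ p μ)}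
    (hπ : π.IsIsometric) (σ : ContractiveRep A (Lp ℂ p ν)) {n : ℕ}
    (a : Matrix (Fin n) (Fin n) A) : ‖amplify p σ a‖ ≤ ‖amplify p π a‖ := by
  let e := lpSumIsometry μ ν ℂ ℂ hp
  let ρ := ContractiveRep.prod p π σ
  let τ := ρ.restrict e.toLinearIsometry fun b f =>
    ⟨e.symm (ρ.hom b (e f)), e.apply_symm_apply _⟩
  have hτ : Intertwines e.symm.toLinearIsometry ρ τ :=
    Intertwines.symm (ρ.intertwines_restrict e.toLinearIsometry _)
  have : TopologicalSpace.SeparableSpace (Lp ℂ p (sumMeasure μ ν)) :=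
    e.symm.toHomeomorph.surjective.denseRange.separableSpace e.symm.continuous
  have hτ_isometric : τ.IsIsometric :=
    hτ.isIsometric ((ContractiveRep.intertwines_prodInl π σ).isIsometric hπ)
  calc ‖amplify p σ a‖ ≤ ‖amplify p ρ a‖ :=
        (ContractiveRep.intertwines_prodInr π σ).norm_amplify_le a
    _ ≤ ‖amplify p τ a‖ := hτ.norm_amplify_le a
    _ = ‖amplify p π a‖ := hunique X (X ⊕ Y) μ (sumMeasure μ ν) π τ hπ hτ_isometric n a

end Domination

/-! ### Separable subrepresentations on `L^p` spaces -/

section CountableClosure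

theorem exists_countable_closed {α : Type*} {C : Set α} (hC : C.Countable) {F : α → α → Set α}
    (hF : ∀ s t, (F s t).Countable) :
    ∃ D : Set α, D.Countable ∧ C ⊆ D ∧ ∀ s ∈ D, ∀ t ∈ D, F s t ⊆ D := by
  let step (D : Set α) : Set α := D ∪ ⋃ s ∈ D, ⋃ t ∈ D, F s t
  have hsucc (k : ℕ) : step^[k + 1] C = step (step^[k] C) := Function.iterate_succ_apply' _ _ _
  have hmono : Monotone fun k => step^[k] C := monotone_nat_of_le_succ fun k => by
    rw [hsucc]
    exact Set.subset_union_left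
  refine ⟨⋃ k, step^[k] C, Set.countable_iUnion fun k => ?_,
    Set.subset_iUnion (fun k => step^[k] C) 0, ?_⟩
  · induction k with
    | zero => exact hC
    | succ k ih =>
      rw [hsucc]
      exact ih.union (ih.biUnion fun s _ => ih.biUnion fun t _ => hF s t)
  · intro s hs t ht r hr
    obtain ⟨k, hk⟩ := Set.mem_iUnion.1 hs
    obtain ⟨l, hl⟩ := Set.mem_iUnion.1 ht
    refine Set.mem_iUnion.2 ⟨max k l + 1, ?_⟩
    rw [hsucc]
    exact Or.inr (Set.mem_biUnion (hmono (le_max_left k l) hk)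
      (Set.mem_biUnion (hmono (le_max_right k l) hl) hr))

variable {X : Type*} [MeasurableSpace X]

theorem exists_countable_isSetAlgebra {𝒞 : Set (Set X)} (h𝒞 : 𝒞.Countable)
    (h𝒞m : ∀ s ∈ 𝒞, MeasurableSet s) {F : Set X → Set (Set X)} (hF : ∀ s, (F s).Countable)
    (hFm : ∀ s, ∀ t ∈ F s, MeasurableSet t) :
    ∃ 𝒜 : Set (Set X), 𝒜.Countable ∧ IsSetAlgebra 𝒜 ∧ (∀ s ∈ 𝒜, MeasurableSet s) ∧ 𝒞 ⊆ 𝒜 ∧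
      ∀ s ∈ 𝒜, F s ⊆ 𝒜 := by
  obtain ⟨D, hD, h𝒞D, hFD⟩ := exists_countable_closed (h𝒞.insert ∅)
    (F := fun s t => {sᶜ, s ∪ t} ∪ F s)
    fun s t => ((Set.countable_singleton (s ∪ t)).insert sᶜ).union (hF s)
  refine ⟨D ∩ {s | MeasurableSet s}, hD.mono Set.inter_subset_left, ⟨?_, ?_, ?_⟩,
    fun s hs => hs.2, fun s hs => ⟨h𝒞D (Or.inr hs), h𝒞m s hs⟩,
    fun s hs t ht => ⟨hFD s hs.1 s hs.1 (Or.inr ht), hFm s t ht⟩⟩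
  · exact ⟨h𝒞D (Or.inl rfl), MeasurableSet.empty⟩
  · exact fun s hs => ⟨hFD s hs.1 s hs.1 (Or.inl (Or.inl rfl)), hs.2.compl⟩
  · exact fun s t hs ht => ⟨hFD s hs.1 t ht.1 (Or.inl (Or.inr rfl)), hs.2.union ht.2⟩

end CountableClosure

section GeneratingPreimages

variable {X Z : Type*} [MeasurableSpace Z] [MeasurableSpace.CountablyGenerated Z]

/-- Countably many sets generating the smallest `σ`-algebra for which `f` is measurable. -/
def generatingPreimages (f : X → Z) : Set (Set X) :=
  (f ⁻¹' ·) '' MeasurableSpace.countableGeneratingSet Z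

theorem countable_generatingPreimages (f : X → Z) : (generatingPreimages f).Countable :=
  MeasurableSpace.countable_countableGeneratingSet.image _

theorem measurableSet_of_mem_generatingPreimages [MeasurableSpace X] {f : X → Z}
    (hf : Measurable f) {s : Set X} (hs : s ∈ generatingPreimages f) : MeasurableSet s := by
  obtain ⟨U, hU, rfl⟩ := hs
  exact hf (MeasurableSpace.measurableSet_countableGeneratingSet hU)

theorem measurable_generateFrom_of_generatingPreimages_subset {f : X → Z} {𝒜 : Set (Set X)}
    (h : generatingPreimages f ⊆ 𝒜) : Measurable[MeasurableSpace.generateFrom 𝒜] f := by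
  rw [← MeasurableSpace.generateFrom_countableGeneratingSet (α := Z)]
  exact @measurable_generateFrom _ _ (MeasurableSpace.generateFrom 𝒜) _ _ fun U hU =>
    MeasurableSpace.measurableSet_generateFrom (h ⟨U, hU, rfl⟩)

end GeneratingPreimages

section LpMeas

variable {𝕜 : Type*} [RCLike 𝕜] {p : ℝ≥0∞} {X : Type*}

theorem mem_lpMeas_of_generatingPreimages_subset [MeasurableSpace X] {μ : Measure X}
    {𝒜 : Set (Set X)} {f : Lp 𝕜 p μ} (h : generatingPreimages f ⊆ 𝒜) :
    f ∈ lpMeas 𝕜 𝕜 (MeasurableSpace.generateFrom 𝒜) p μ :=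
  mem_lpMeas_iff_aestronglyMeasurable.2 (StronglyMeasurable.aestronglyMeasurable
    (measurable_generateFrom_of_generatingPreimages_subset h).stronglyMeasurable)

variable [Fact (1 ≤ p)]

variable (𝕜 p) in
/-- The isometric inclusion of the `L^p` space of a sub-`σ`-algebra. -/
def lpTrimIncl {m mX : MeasurableSpace X} (μ : Measure X) (hm : m ≤ mX) :
    Lp 𝕜 p (μ.trim hm) →ₗᵢ[𝕜] Lp 𝕜 p μ :=
  (lpMeas 𝕜 𝕜 m p μ).subtypeₗᵢ.comp (lpMeasToLpTrimLie 𝕜 𝕜 p μ hm).symm.toLinearIsometry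

theorem range_lpTrimIncl {m mX : MeasurableSpace X} (μ : Measure X) (hm : m ≤ mX) :
    LinearMap.range (lpTrimIncl 𝕜 p μ hm).toLinearMap = lpMeas 𝕜 𝕜 m p μ := by
  ext f
  constructor
  · rintro ⟨g, rfl⟩
    exact ((lpMeasToLpTrimLie 𝕜 𝕜 p μ hm).symm g).2
  · intro hf
    exact ⟨lpMeasToLpTrimLie 𝕜 𝕜 p μ hm ⟨f, hf⟩, by simp [lpTrimIncl]⟩

theorem lpTrimIncl_indicatorConstLp {m mX : MeasurableSpace X} {μ : Measure X} (hm : m ≤ mX)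
    {s : Set X} (hs : MeasurableSet[m] s) (hμ : μ.trim hm s ≠ ∞) (c : 𝕜) :
    lpTrimIncl 𝕜 p μ hm (indicatorConstLp p hs hμ c) =
      indicatorConstLp p (hm s hs) ((le_trim hm).trans_lt hμ.lt_top).ne c :=
  lpMeasToLpTrimLie_symm_indicator (hm := hm) hs hμ c

theorem eq_top_of_indicatorConstLp_mem {m : MeasurableSpace X} {ν : Measure X} (hp : p ≠ ∞)
    {𝒜 : Set (Set X)} (h𝒜 : ν.MeasureDense 𝒜) {K : Submodule 𝕜 (Lp 𝕜 p ν)}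
    (hK : IsClosed (K : Set (Lp 𝕜 p ν)))
    (h : ∀ s ∈ 𝒜, ∀ (hs : MeasurableSet s) (hν : ν s ≠ ∞), indicatorConstLp p hs hν 1 ∈ K) :
    K = ⊤ := by
  have : Fact (p ≠ ∞) := ⟨hp⟩
  refine K.eq_top_iff'.2 (Lp.induction hp _ (fun c s hs hν => ?_)
    (fun f g _ _ _ hf hg => K.add_mem hf hg) hK)
  have hone : indicatorConstLp p hs hν.ne (1 : 𝕜) ∈ K := by
    refine closure_minimal ?_ hK
      (h𝒜.indicatorConstLp_subset_closure p 1 ⟨s, hs, hν.ne, rfl⟩)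
    rintro _ ⟨t, ht, hνt, rfl⟩
    exact h t ht _ hνt
  have hsmul : indicatorConstLp p hs hν.ne c = c • indicatorConstLp p hs hν.ne (1 : 𝕜) := by
    rw [indicatorConstLp, indicatorConstLp, ← MemLp.toLp_const_smul]
    refine MemLp.toLp_congr _ _ (.of_forall fun x => ?_)
    by_cases hx : x ∈ s <;> simp [hx]
  rw [Lp.simpleFunc.coe_indicatorConst, hsmul]
  exact K.smul_mem c hone

theorem map_mem_lpMeas {m mX : MeasurableSpace X} {μ : Measure X} (hp : p ≠ ∞) (hm : m ≤ mX)
    {𝒜 : Set (Set X)} (h𝒜 : Measure.MeasureDense (m := m) (μ.trim hm) 𝒜)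
    {T : Lp 𝕜 p μ →L[𝕜] Lp 𝕜 p μ}
    (hT : ∀ s ∈ 𝒜, ∀ (hs : MeasurableSet[mX] s) (hμ : μ s ≠ ∞),
      T (indicatorConstLp p hs hμ 1) ∈ lpMeas 𝕜 𝕜 m p μ) {g : Lp 𝕜 p μ}
    (hg : g ∈ lpMeas 𝕜 𝕜 m p μ) : T g ∈ lpMeas 𝕜 𝕜 m p μ := by
  rw [← range_lpTrimIncl μ hm] at hg
  obtain ⟨g, rfl⟩ := hg
  let K := (lpMeas 𝕜 𝕜 m p μ).comap
    ((T : Lp 𝕜 p μ →ₗ[𝕜] Lp 𝕜 p μ) ∘ₗ (lpTrimIncl 𝕜 p μ hm).toLinearMap)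
  have hclosed : IsClosed (K : Set (Lp 𝕜 p (μ.trim hm))) :=
    (isClosed_aestronglyMeasurable hm).preimage
      (T.continuous.comp (lpTrimIncl 𝕜 p μ hm).continuous)
  have htop : K = ⊤ := eq_top_of_indicatorConstLp_mem hp h𝒜 hclosed fun s hs hsm hμs => by
    change T (lpTrimIncl 𝕜 p μ hm _) ∈ lpMeas 𝕜 𝕜 m p μ
    rw [lpTrimIncl_indicatorConstLp]
    exact hT s hs _ _
  exact K.eq_top_iff'.1 htop g

/-- Finite spanning sets of `μ` lying in `𝒜` also span for the restriction of `μ` to the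
`σ`-algebra generated by `𝒜`. -/
def finiteSpanningSetsInTrim [mX : MeasurableSpace X] {μ : Measure X} {𝒜 ℬ : Set (Set X)}
    (hm : MeasurableSpace.generateFrom 𝒜 ≤ mX) (S : μ.FiniteSpanningSetsIn ℬ)
    (hS : ∀ k, S.set k ∈ 𝒜) : (μ.trim hm).FiniteSpanningSetsIn 𝒜 where
  set := S.set
  set_mem := hS
  finite k := by
    rw [trim_measurableSet_eq hm (MeasurableSpace.measurableSet_generateFrom (hS k))]
    exact S.finite k
  spanning := S.spanning

theorem exists_countablyGenerated_invariant [mX : MeasurableSpace X] {μ : Measure X}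
    [SigmaFinite μ] (hp : p ≠ ∞) {ι : Type*} [Countable ι] (T : ι → Lp 𝕜 p μ →L[𝕜] Lp 𝕜 p μ)
    {C : Set (Lp 𝕜 p μ)} (hC : C.Countable) :
    ∃ (𝒜 : Set (Set X)) (hm : MeasurableSpace.generateFrom 𝒜 ≤ mX), 𝒜.Countable ∧
      SigmaFinite (μ.trim hm) ∧ C ⊆ lpMeas 𝕜 𝕜 (MeasurableSpace.generateFrom 𝒜) p μ ∧
      ∀ k, ∀ g ∈ lpMeas 𝕜 𝕜 (MeasurableSpace.generateFrom 𝒜) p μ,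
        T k g ∈ lpMeas 𝕜 𝕜 (MeasurableSpace.generateFrom 𝒜) p μ := by
  let S := μ.toFiniteSpanningSetsIn
  have hpre (f : Lp 𝕜 p μ) : ∀ s ∈ generatingPreimages f, MeasurableSet s := fun s =>
    measurableSet_of_mem_generatingPreimages (Lp.stronglyMeasurable f).measurable
  let 𝒞 : Set (Set X) := Set.range S.set ∪ ⋃ f ∈ C, generatingPreimages f
  have h𝒞 : 𝒞.Countable :=
    (Set.countable_range _).union (hC.biUnion fun f _ => countable_generatingPreimages f)
  have h𝒞_meas : ∀ s ∈ 𝒞, MeasurableSet s := by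
    rintro s (⟨k, rfl⟩ | hs)
    · exact S.set_mem k
    · obtain ⟨f, -, hs⟩ := Set.mem_iUnion₂.1 hs
      exact hpre f s hs
  -- Closing `𝒜` under `F` makes each `T k 1_s`, `s ∈ 𝒜`, measurable for the `σ`-algebra of `𝒜`.
  let F (s : Set X) : Set (Set X) := ⋃ k, ⋃ (hs : MeasurableSet s), ⋃ (hμ : μ s ≠ ∞),
    generatingPreimages (T k (indicatorConstLp p hs hμ 1))
  have hF (s : Set X) : (F s).Countable := Set.countable_iUnion fun k =>
    Set.countable_iUnion fun hs => Set.countable_iUnion fun hμ => countable_generatingPreimages _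
  have hF_meas (s t : Set X) (ht : t ∈ F s) : MeasurableSet t := by
    simp only [F, Set.mem_iUnion] at ht
    obtain ⟨k, hs, hμ, ht⟩ := ht
    exact hpre _ t ht
  obtain ⟨𝒜, hcount, halg, hmeas, hsub, hclosed⟩ :=
    exists_countable_isSetAlgebra h𝒞 h𝒞_meas hF fun s => hF_meas s
  have hm : MeasurableSpace.generateFrom 𝒜 ≤ mX := MeasurableSpace.generateFrom_le hmeas
  let S' := finiteSpanningSetsInTrim hm S fun k => hsub (Or.inl ⟨k, rfl⟩)
  refine ⟨𝒜, hm, hcount, S'.sigmaFinite, fun f hf => ?_, fun k g => ?_⟩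
  · exact mem_lpMeas_of_generatingPreimages_subset
      ((Set.subset_biUnion_of_mem (u := fun f : Lp 𝕜 p μ => generatingPreimages f) hf).trans
        (Set.subset_union_right.trans hsub))
  · refine map_mem_lpMeas hp hm
      (Measure.MeasureDense.of_generateFrom_isSetAlgebra_sigmaFinite
        (m := MeasurableSpace.generateFrom 𝒜) halg S' rfl)
      fun s hs hsm hμ => mem_lpMeas_of_generatingPreimages_subset fun t ht => hclosed s hs ?_
    exact Set.mem_iUnion.2 ⟨k, Set.mem_iUnion₂.2 ⟨hsm, hμ, ht⟩⟩

end LpMeas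

theorem exists_separable_subrep {A : Type w} [NonUnitalNormedRing A] [NormedSpace ℂ A]
    [TopologicalSpace.SeparableSpace A] {p : ℝ≥0∞} [Fact (1 ≤ p)] (hp : p ≠ ∞) {X : Type u}
    [mX : MeasurableSpace X] {μ : Measure X} [SigmaFinite μ] (π : ContractiveRep A (Lp ℂ p μ))
    {C : Set (Lp ℂ p μ)} (hC : C.Countable) :
    ∃ (Y : Type u) (_ : MeasurableSpace Y) (ν : Measure Y) (_ : SigmaFinite ν)
      (_ : TopologicalSpace.SeparableSpace (Lp ℂ p ν)) (σ : ContractiveRep A (Lp ℂ p ν))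
      (V : Lp ℂ p ν →ₗᵢ[ℂ] Lp ℂ p μ), Intertwines V σ π ∧ C ⊆ Set.range V := by
  obtain ⟨𝒜, hm, hcount, hσ, hCm, hinv⟩ := exists_countablyGenerated_invariant hp
    (fun k => π.hom (TopologicalSpace.denseSeq A k)) hC
  let M := lpMeas ℂ ℂ (MeasurableSpace.generateFrom 𝒜) p μ
  have hrange : LinearMap.range (lpTrimIncl ℂ p μ hm).toLinearMap = M := range_lpTrimIncl μ hm
  have hmem (a : A) (g : Lp ℂ p (μ.trim hm)) : π.hom a (lpTrimIncl ℂ p μ hm g) ∈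
      LinearMap.range (lpTrimIncl ℂ p μ hm).toLinearMap := by
    have hg : lpTrimIncl ℂ p μ hm g ∈ M := hrange ▸ LinearMap.mem_range_self _ g
    rw [hrange]
    exact (TopologicalSpace.denseRange_denseSeq A).induction_on
      (p := fun a => π.hom a (lpTrimIncl ℂ p μ hm g) ∈ M) a
      ((isClosed_aestronglyMeasurable hm).preimage
        (π.continuous_hom.clm_apply continuous_const)) fun k => hinv k _ hg
  have : Fact (p ≠ ∞) := ⟨hp⟩
  have hgen : @MeasurableSpace.CountablyGenerated X (MeasurableSpace.generateFrom 𝒜) :=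
    @MeasurableSpace.CountablyGenerated.mk X (MeasurableSpace.generateFrom 𝒜) ⟨𝒜, hcount, rfl⟩
  refine ⟨X, MeasurableSpace.generateFrom 𝒜, μ.trim hm, hσ, inferInstance,
    π.restrict _ hmem, lpTrimIncl ℂ p μ hm, π.intertwines_restrict _ hmem, fun f hf => ?_⟩
  have hfM : f ∈ M := hCm hf
  rwa [← hrange] at hfM

/-! ### Comparison of matrix norms -/

section Comparison

open TopologicalSpace

theorem exists_countable_norming {𝕜 : Type*} [RCLike 𝕜] {A E F : Type*} [TopologicalSpace A]
    [SeparableSpace A] [NormedAddCommGroup E] [NormedSpace 𝕜 E] [NormedAddCommGroup F]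
    [NormedSpace 𝕜 F] {T : A → E →L[𝕜] F} (hT : Continuous T) :
    ∃ C : Set E, C.Countable ∧ (∀ x ∈ C, ‖x‖ ≤ 1) ∧
      ∀ a M, (∀ x ∈ C, ‖T a x‖ ≤ M) → ‖T a‖ ≤ M := by
  obtain ⟨D, hD, hDdense⟩ := exists_countable_dense A
  have hex (a : A) (j : ℕ) : ∃ x : E, ‖x‖ < 1 ∧ ‖T a‖ - 1 / (j + 1) < ‖T a x‖ :=
    (T a).exists_lt_apply_of_lt_opNorm (sub_lt_self _ Nat.one_div_pos_of_nat)
  choose x hx_norm hx using hex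
  refine ⟨⋃ a ∈ D, Set.range (x a), hD.biUnion fun a _ => Set.countable_range _, fun y hy => ?_,
    fun a M hM => le_of_forall_pos_le_add fun ε hε => ?_⟩
  · obtain ⟨a, -, j, rfl⟩ := Set.mem_iUnion₂.1 hy
    exact (hx_norm a j).le
  have hε₃ : 0 < ε / 3 := by positivity
  obtain ⟨b, hbD, hb⟩ := hDdense.exists_mem_open (Metric.isOpen_ball.preimage hT)
    ⟨a, Metric.mem_ball_self (x := T a) hε₃⟩
  obtain ⟨j, hj⟩ := exists_nat_one_div_lt hε₃
  have hab : ‖T a - T b‖ < ε / 3 := by rwa [← dist_eq_norm, dist_comm]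
  have hab_apply : ‖(T b - T a) (x b j)‖ ≤ ‖T a - T b‖ := by
    rw [norm_sub_rev (T a)]
    exact (T b - T a).unit_le_opNorm _ (hx_norm b j).le
  have hTa : ‖T a‖ ≤ ‖T b‖ + ‖T a - T b‖ := norm_le_norm_add_norm_sub' _ _
  have hTb : ‖T b (x b j)‖ ≤ ‖T a (x b j)‖ + ‖(T b - T a) (x b j)‖ :=
    norm_le_norm_add_norm_sub' _ _
  linarith [hx b j, hM _ (Set.mem_biUnion hbD ⟨j, rfl⟩)]

variable {p : ℝ≥0∞} [Fact (1 ≤ p)] {A : Type w} [NonUnitalNormedRing A] [NormedSpace ℂ A]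
  [SeparableSpace A]

theorem exists_isometric_separable_subrep (hp : p ≠ ∞) {X : Type u} [MeasurableSpace X]
    {μ : Measure X} [SigmaFinite μ] {π : ContractiveRep A (Lp ℂ p μ)} (hπ : π.IsIsometric) :
    ∃ (Y : Type u) (_ : MeasurableSpace Y) (ν : Measure Y) (_ : SigmaFinite ν)
      (_ : SeparableSpace (Lp ℂ p ν)) (σ : ContractiveRep A (Lp ℂ p ν))
      (V : Lp ℂ p ν →ₗᵢ[ℂ] Lp ℂ p μ), Intertwines V σ π ∧ σ.IsIsometric := by
  obtain ⟨C, hC, hC_norm, hnorming⟩ := exists_countable_norming π.continuous_hom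
  obtain ⟨Y, _, ν, hν, hsep, σ, V, hV, hCV⟩ := exists_separable_subrep hp π hC
  refine ⟨Y, _, ν, hν, hsep, σ, V, hV, fun a => (σ.norm_le a).antisymm ?_⟩
  rw [← hπ a]
  refine hnorming a _ fun x hx => ?_
  obtain ⟨y, rfl⟩ := hCV hx
  rw [← hV, V.norm_map]
  exact (σ.hom a).unit_le_opNorm y (V.norm_map y ▸ hC_norm _ hx)

theorem norm_amplify_le_of_isIsometric (hp : p ≠ ∞)
    (hunique : HasUniqueLpMatrixNorms.{u, w} p A) {X Y : Type u} [MeasurableSpace X]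
    [MeasurableSpace Y] {μ : Measure X} {ν : Measure Y} [SigmaFinite μ] [SigmaFinite ν]
    {π : ContractiveRep A (Lp ℂ p μ)} (hπ : π.IsIsometric) (σ : ContractiveRep A (Lp ℂ p ν))
    {n : ℕ} (a : Matrix (Fin n) (Fin n) A) : ‖amplify p σ a‖ ≤ ‖amplify p π a‖ := by
  obtain ⟨X', _, μ', _, _, π', V, hV, hπ'⟩ := exists_isometric_separable_subrep hp hπ
  refine ContinuousLinearMap.opNorm_le_bound _ (norm_nonneg _) fun x => ?_
  obtain ⟨Y', _, ν', _, _, σ', W, hW, hxW⟩ :=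
    exists_separable_subrep hp σ (Set.countable_range fun i => x i)
  choose y hy using fun i => hxW ⟨i, rfl⟩
  have hxy : piLpMap p W (WithLp.toLp p y) = x := PiLp.ext hy
  have hle : ‖amplify p σ' a‖ ≤ ‖amplify p π a‖ :=
    (norm_amplify_le_of_separable hp hunique hπ' σ' a).trans (hV.norm_amplify_le a)
  rw [← hxy, ← hW.piLpMap_amplify, LinearIsometry.norm_map, LinearIsometry.norm_map]
  exact ContinuousLinearMap.le_of_opNorm_le _ hle _

end Comparison

/-! ### Extension of isometric homomorphisms to the completion -/

section Extension

open UniformSpace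

variable {p : ℝ≥0∞} [Fact (1 ≤ p)] {G : Type v} {A : Type w} [Group G]
  [NonUnitalNormedRing A] [NormedSpace ℂ A] {α : IsometricAction G A} {B : Type*}
  [NonUnitalNormedRing B] [NormedSpace ℂ B] [CompleteSpace B]

theorem exists_isometric_extension (φ : Cc.{u, v, w} p α →ₙₐ[ℂ] B) (hφ : ∀ f, ‖φ f‖ = ‖f‖) :
    ∃ Φ : ReducedCrossedProduct.{u, v, w} p α →ₙₐ[ℂ] B, (∀ f : Cc.{u, v, w} p α, Φ f = φ f) ∧
      ∀ x, ‖Φ x‖ = ‖x‖ := by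
  have hφ_isometry : Isometry φ := AddMonoidHomClass.isometry_of_norm φ hφ
  let Φ : ReducedCrossedProduct.{u, v, w} p α → B := Completion.extension φ
  have hcoe (f : Cc.{u, v, w} p α) : Φ f = φ f :=
    Completion.extension_coe hφ_isometry.uniformContinuous f
  have hΦ : Continuous Φ := Completion.continuous_extension
  refine ⟨{ toFun := Φ, map_smul' := fun c x => ?_, map_zero' := ?_, map_add' := fun x y => ?_,
            map_mul' := fun x y => ?_ }, hcoe, fun x => ?_⟩
  · exact Completion.induction_on x
      (isClosed_eq (hΦ.comp (continuous_const_smul c)) (hΦ.const_smul c)) fun f => by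
        rw [← Completion.coe_smul, hcoe, hcoe, map_smul]; rfl
  · rw [← Completion.coe_zero, hcoe, map_zero]
  · exact Completion.induction_on₂ x y (isClosed_eq (by fun_prop) (by fun_prop)) fun f g => by
      rw [← Completion.coe_add, hcoe, hcoe, hcoe, map_add]
  · exact Completion.induction_on₂ x y (isClosed_eq (by fun_prop) (by fun_prop)) fun f g => by
      rw [← coe_mul, hcoe, hcoe, hcoe, map_mul]
  · exact Completion.induction_on x (isClosed_eq hΦ.norm continuous_norm) fun f =>
      (congrArg norm (hcoe f)).trans ((hφ f).trans (Completion.norm_coe f).symm)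

end Extension

end LpCrossed

end

theorem lemma2p5_general (p : ℝ≥0∞) [Fact (1 ≤ p)] (hp : p ≠ ∞) {G : Type v} [Group G]
    {A : Type w} [NonUnitalNormedRing A] [NormedSpace ℂ A] [TopologicalSpace.SeparableSpace A]
    (hunique : LpCrossed.HasUniqueLpMatrixNorms.{u, w} p A)
    (α : LpCrossed.IsometricAction G A)
    {X : Type u} [MeasurableSpace X] (μ : Measure X) [SigmaFinite μ]
    (π₀ : LpCrossed.ContractiveRep A (Lp ℂ p μ))
    (hnd : π₀.Nondegenerate) (hiso : π₀.IsIsometric) :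
    ∃ Φ : LpCrossed.ReducedCrossedProduct.{u, v, w} p α →ₙₐ[ℂ]
        (LpCrossed.lpG p G (Lp ℂ p μ) →L[ℂ] LpCrossed.lpG p G (Lp ℂ p μ)),
      (∀ f : LpCrossed.Cc.{u, v, w} p α, Φ f = LpCrossed.integratedForm π₀ f) ∧
      ∀ x, ‖Φ x‖ = ‖x‖ :=
  LpCrossed.exists_isometric_extension (LpCrossed.integratedForm π₀) fun f =>
    (LpCrossed.norm_le_reducedNorm f μ π₀ hnd).antisymm <|
      LpCrossed.reducedNorm_le f fun _Y _ _ν _ σ _ =>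
        LpCrossed.norm_integratedForm_mono hp
          (fun _ a => LpCrossed.norm_amplify_le_of_isIsometric hp hunique hiso σ a) f

theorem lemma2p5 (p : ℝ≥0∞) [Fact (1 ≤ p)] (hp : p ≠ ∞)
    {G : Type v} [Group G] [Countable G]
    {A : Type w} [NonUnitalNormedRing A] [NormedSpace ℂ A] [IsScalarTower ℂ A A]
    [SMulCommClass ℂ A A] [CompleteSpace A] [TopologicalSpace.SeparableSpace A]
    (hA : LpCrossed.IsLpOperatorAlgebra.{u, w} p A)
    (hunique : LpCrossed.HasUniqueLpMatrixNorms.{u, w} p A)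
    (α : LpCrossed.IsometricAction G A)
    {X : Type u} [MeasurableSpace X] (μ : Measure X) [SigmaFinite μ]
    (π₀ : LpCrossed.ContractiveRep A (Lp ℂ p μ))
    (hnd : π₀.Nondegenerate) (hiso : π₀.IsIsometric) :
    ∃ Φ : LpCrossed.ReducedCrossedProduct.{u, v, w} p α →ₙₐ[ℂ]
        (LpCrossed.lpG p G (Lp ℂ p μ) →L[ℂ] LpCrossed.lpG p G (Lp ℂ p μ)),
      (∀ f : LpCrossed.Cc.{u, v, w} p α, Φ f = LpCrossed.integratedForm π₀ f) ∧
      ∀ x, ‖Φ x‖ = ‖x‖ :=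
  lemma2p5_general p hp hunique α μ π₀ hnd hiso
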